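/- Let $\mathcal{L}_{\mathrm{TST}}$ be the many-sorted first-order language with one sort (type) for each $n\in\mathbb{N}$, variables $x^n,y^n,\dots$ of each type $n$, and atomic formulas $x^n=y^n$ and $x^n\in_n y^{n+1}$. Let $\mathrm{TST}$ be the $\mathcal{L}_{\mathrm{TST}}$-theory with the axioms, for all $n\in\mathbb{N}$, - (Extensionality) $\forall x^{n+1}\forall y^{n+1}\,\bigl(x^{n+1}=y^{n+1}\leftrightarrow\forall z^n(z^n\in_n x^{n+1}\leftrightarrow z^n\in_n y^{n+1})\bigr)$, - (Comprehension) $\forall\vec z\,\exists y^{n+1}\forall x^n\,\bigl(x^n\in_n y^{n+1}\leftrightarrow\varphi(x^n,\vec z)\bigr)$ for every $\mathcal{L}_{\mathrm{TST}}$-formula $\varphi(x^n,\vec z)$ in which $y^{n+1}$ does not occur free, and let $\mathrm{TSTI}$ be $\mathrm{TST}$ together with the axiom of infinity $$\exists x^1\exists f^3\,(f^3:x^1\to x^1\text{ is injective but not surjective}),$$ where functions are sets of ordered pairs $\langle a,b\rangle=\{\{a\},\{a,b\}\}$. A theory $T$ decides a sentence $\phi$ if $T\vdash\phi$ or $T\vdash\neg\phi$,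 where $\vdash$ is derivability in classical many-sorted first-order logic with equality. Let $k,l\in\mathbb{N}$, let $r_1,\dots,r_k,s_1,\dots,s_l\in\mathbb{N}$ with $s_1>\dots>s_l$, let $\theta$ be a quantifier-free $\mathcal{L}_{\mathrm{TST}}$-formula, and suppose that $$\phi=\forall x_1^{r_1}\cdots\forall x_k^{r_k}\,\exists y_1^{s_1}\cdots\exists y_l^{s_l}\,\theta$$ is a sentence. Then $\mathrm{TSTI}$ decides $\phi$. -/

import Mathlib

namespace TST

/-- Formulas of the many-sorted language of type theory, with one sort (type) for each natural
number and one membership symbol between type `n` and type `n + 1`.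

The variables of type `n` are numbered `0, 1, 2, …` and bound variables are de Bruijn indices,
counted separately for each type: `all n φ` binds the variable `0` of type `n` in `φ`, the variable
`i + 1` of type `n` in `φ` is the variable `i` of type `n` outside, and the variables of all other
types keep their index.  There are no terms except variables. -/
inductive Formula : Type where
  /-- `eq n i j` is the atomic formula `xᵢⁿ = xⱼⁿ`. -/
  | eq (n i j : ℕ) : Formula
  /-- `mem n i j` is the atomic formula `xᵢⁿ ∈ₙ xⱼⁿ⁺¹`. -/
  | mem (n i j : ℕ) : Formula
  | bot : Formula
  | imp (φ ψ : Formula) : Formula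
  | all (n : ℕ) (φ : Formula) : Formula

/-- A renaming of variables: `ρ n i` is the index of the variable of type `n` that replaces the
variable `i` of type `n`. -/
abbrev Renaming : Type := ℕ → ℕ → ℕ

namespace Renaming

/-- The renaming `ρ` below a quantifier of type `m`. -/
def lift (m : ℕ) (ρ : Renaming) : Renaming := fun n i =>
  if n = m then
    match i with
    | 0 => 0
    | j + 1 => ρ n j + 1
  else ρ n i

/-- Makes room for a new variable `0` of type `m`. -/
def shift (m : ℕ) : Renaming := fun n i => if n = m then i + 1 else i

/-- Replaces the variable `0` of type `m` by the variable `k` of type `m`, and removes the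
quantifier level that it belonged to. -/
def inst (m k : ℕ) : Renaming := fun n i =>
  if n = m then
    match i with
    | 0 => k
    | j + 1 => j
  else i

end Renaming

namespace Formula

/-- Simultaneous, capture-avoiding replacement of the free variables. -/
def rename : Renaming → Formula → Formula
  | ρ, eq n i j => eq n (ρ n i) (ρ n j)
  | ρ, mem n i j => mem n (ρ n i) (ρ (n + 1) j)
  | _, bot => bot
  | ρ, imp φ ψ => imp (rename ρ φ) (rename ρ ψ)
  | ρ, all m φ => all m (rename (ρ.lift m) φ)

/-- Negation. -/
def neg (φ : Formula) : Formula := imp φ bot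

/-- Conjunction. -/
def conj (φ ψ : Formula) : Formula := neg (imp φ (neg ψ))

/-- Disjunction. -/
def disj (φ ψ : Formula) : Formula := imp (neg φ) ψ

/-- Biconditional. -/
def bicond (φ ψ : Formula) : Formula := conj (imp φ ψ) (imp ψ φ)

/-- Existential quantifier over type `n`. -/
def ex (n : ℕ) (φ : Formula) : Formula := neg (all n (neg φ))

/-- `allBlock [r₁, …, rₖ] φ` is `∀ x₁^{r₁} ⋯ ∀ xₖ^{rₖ} φ`. -/
def allBlock (r : List ℕ) (φ : Formula) : Formula := r.foldr all φ

/-- `exBlock [s₁, …, sₗ] φ` is `∃ y₁^{s₁} ⋯ ∃ yₗ^{sₗ} φ`. -/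
def exBlock (s : List ℕ) (φ : Formula) : Formula := s.foldr ex φ

/-- `φ.IsFree n i`: the variable `i` of type `n` occurs free in `φ`. -/
def IsFree : Formula → ℕ → ℕ → Prop
  | eq m a b, n, i => n = m ∧ (i = a ∨ i = b)
  | mem m a b, n, i => (n = m ∧ i = a) ∨ (n = m + 1 ∧ i = b)
  | bot, _, _ => False
  | imp φ ψ, n, i => IsFree φ n i ∨ IsFree ψ n i
  | all m φ, n, i => IsFree φ n (if n = m then i + 1 else i)

/-- A sentence is a formula without free variables. -/
def IsSentence (φ : Formula) : Prop := ∀ n i, ¬ φ.IsFree n i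

/-- No quantifier occurs in the formula. -/
def IsQuantifierFree : Formula → Prop
  | eq _ _ _ => True
  | mem _ _ _ => True
  | bot => True
  | imp φ ψ => IsQuantifierFree φ ∧ IsQuantifierFree ψ
  | all _ _ => False

end Formula

open Formula

/-- Classical natural deduction for many-sorted first-order logic with equality:
`Derives Γ φ` says that `φ` is derivable from the finite list `Γ` of assumptions. -/
inductive Derives : List Formula → Formula → Prop where
  | assumption {Γ : List Formula} {φ : Formula} (h : φ ∈ Γ) : Derives Γ φ
  | impIntro {Γ : List Formula} {φ ψ : Formula} (h : Derives (φ :: Γ) ψ) :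
      Derives Γ (imp φ ψ)
  | impElim {Γ : List Formula} {φ ψ : Formula} (h : Derives Γ (imp φ ψ)) (h' : Derives Γ φ) :
      Derives Γ ψ
  | byContradiction {Γ : List Formula} {φ : Formula} (h : Derives (neg φ :: Γ) bot) :
      Derives Γ φ
  /-- The generalized variable is new: it does not occur in the shifted assumptions. -/
  | allIntro {Γ : List Formula} {n : ℕ} {φ : Formula}
      (h : Derives (Γ.map (rename (Renaming.shift n))) φ) : Derives Γ (all n φ)
  | allElim {Γ : List Formula} {n : ℕ} {φ : Formula} (i : ℕ) (h : Derives Γ (all n φ)) :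
      Derives Γ (rename (Renaming.inst n i) φ)
  | eqRefl {Γ : List Formula} (n i : ℕ) : Derives Γ (eq n i i)
  | eqSubst {Γ : List Formula} {n i j : ℕ} (φ : Formula) (h : Derives Γ (eq n i j))
      (h' : Derives Γ (rename (Renaming.inst n i) φ)) :
      Derives Γ (rename (Renaming.inst n j) φ)

/-- `Proves T φ`, usually written `T ⊢ φ`: some finite list of members of `T` derives `φ`. -/
def Proves (T : Set Formula) (φ : Formula) : Prop :=
  ∃ Γ : List Formula, (∀ ψ ∈ Γ, ψ ∈ T) ∧ Derives Γ φ

/-- `T` decides `φ` if `T ⊢ φ` or `T ⊢ ¬ φ`. -/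
def Decides (T : Set Formula) (φ : Formula) : Prop :=
  Proves T φ ∨ Proves T (neg φ)

/-- Extensionality at type `n + 1`:
`∀ xⁿ⁺¹ ∀ yⁿ⁺¹ (x = y ↔ ∀ zⁿ (z ∈ x ↔ z ∈ y))`. -/
def extensionality (n : ℕ) : Formula :=
  all (n + 1) (all (n + 1)
    (bicond (eq (n + 1) 1 0) (all n (bicond (mem n 0 1) (mem n 0 0)))))

/-- The matrix `∃ yⁿ⁺¹ ∀ xⁿ (x ∈ y ↔ φ(x, z⃗))` of the comprehension axiom for `φ`.  The variable `x`
is the variable `0` of type `n` in `φ`, and the shift ensures that `y` does not occur in `φ`. -/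
def comprehension (n : ℕ) (φ : Formula) : Formula :=
  ex (n + 1) (all n (bicond (mem n 0 0) (rename (Renaming.shift (n + 1)) φ)))

/-- The theory `TST`: extensionality, and comprehension for every formula.  The list `z` gives
the types of the universally quantified parameters, which have to include all of the parameters of
`φ` because the axiom is a sentence. -/
def theoryTST : Set Formula :=
  {ψ | ∃ n, ψ = extensionality n} ∪
    {ψ | ∃ (n : ℕ) (φ : Formula) (z : List ℕ),
      ψ = allBlock z (comprehension n φ) ∧ ψ.IsSentence}

/-- The variable `p` of type `n + 2` is the Wiener-Kuratowski pair `{{a}, {a, b}}` of the variables `a` and `b` of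
type `n`. -/
def isPair (n p a b : ℕ) : Formula :=
  all (n + 1) (bicond (mem (n + 1) 0 p)
    (disj (all n (bicond (mem n 0 0) (eq n 0 (a + 1))))
      (all n (bicond (mem n 0 0) (disj (eq n 0 (a + 1)) (eq n 0 (b + 1)))))))

/-- `⟨a, b⟩ ∈ f` for `a`, `b` of type `n` and `f` of type `n + 3`. -/
def pairMem (n a b f : ℕ) : Formula :=
  ex (n + 2) (conj (isPair n 0 a b) (mem (n + 2) 0 f))

/-- `f ⊆ x × x`, where `x` is the variable `0` of type `1` and `f` is the variable `0` of
type `3`; the same holds in the next four definitions. -/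
def relOn : Formula :=
  all 2 (imp (mem 2 0 0)
    (ex 0 (ex 0 (conj (conj (mem 0 1 0) (mem 0 0 0)) (isPair 0 0 1 0)))))

/-- `∀ a ∈ x ∃ b ∈ x ⟨a, b⟩ ∈ f`. -/
def totalOn : Formula :=
  all 0 (imp (mem 0 0 0) (ex 0 (conj (mem 0 0 0) (pairMem 0 1 0 0))))

/-- `∀ a ∀ b ∀ c (⟨a, b⟩ ∈ f ∧ ⟨a, c⟩ ∈ f → b = c)`. -/
def functional : Formula :=
  all 0 (all 0 (all 0 (imp (conj (pairMem 0 2 1 0) (pairMem 0 2 0 0)) (eq 0 1 0))))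

/-- `∀ a ∀ b ∀ c (⟨a, c⟩ ∈ f ∧ ⟨b, c⟩ ∈ f → a = b)`. -/
def injective : Formula :=
  all 0 (all 0 (all 0 (imp (conj (pairMem 0 2 0 0) (pairMem 0 1 0 0)) (eq 0 2 1))))

/-- `∃ b ∈ x ∀ a ∈ x ¬ ⟨a, b⟩ ∈ f`. -/
def notSurjective : Formula :=
  ex 0 (conj (mem 0 0 0) (all 0 (imp (mem 0 0 0) (neg (pairMem 0 0 1 0)))))

/-- The axiom of infinity: `∃ x¹ ∃ f³ (f : x → x is injective but not surjective)`. -/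
def infinity : Formula :=
  ex 1 (ex 3
    (conj (conj relOn (conj totalOn functional)) (conj injective notSurjective)))

/-- The theory `TSTI`: `TST` together with the axiom of infinity. -/
def theoryTSTI : Set Formula := insert infinity theoryTST

end TST

/-!
The calculus is complete, by Henkin's method: a consistent set of sentences has a model, whose
objects are the variables modulo provable equality (`Consistent.exists_model`). So it is enough
that a sentence `∀ x⃗ ∃ y₁ ⋯ ∃ yₗ θ` of the given form which holds in one model `N` of `TSTI`
holds in every other model `M` (`decides_of_forall_model`,
`Model.IsTypeTheory.sat_exBlock_of_forall_sat`).

Let a finite set of parameters in `M` be given, and enlarge it to finite sets `A n` of objects of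
type `n` such that the members in `A n` tell apart the elements of `A (n + 1)`. Maps `A n → N`
that respect equality and membership are built upwards through the types, together with an
infinite set of candidates in `M` for each object `y` of `N` of type `n`; they are to stand for
`y` if it is not in the image of `A n`. The elements of `A (n + 1)` divide the candidates into
finitely many cells, so one of the cells is infinite. The image of `a` in `A (n + 1)` is given
those `y` as further members whose infinite cell is inside `a`; it is a set of `N` because only
finitely many cases occur. The candidates at the next type are the objects which have the
prescribed members in `A n` and which split each of the infinite cells (`Model.Stage`,
`Model.Stage.exists_succ`). There are infinitely many of them, because all finite sets exist in
`M`.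

Given objects `y n` of `N`, one of each type, substitutes for them are now chosen in `M` from the
highest type downwards. Those outside the image of `A n` are replaced by candidates in the
infinite cell, which gives the right memberships relative to the parameters. The substitute for `y
n` can be taken inside or outside of the one for `y (n + 1)`, as required, because the latter
splits the cell (`Model.Stage.Partner.exists_partner`, `Model.IsTypeTheory.exists_matching`). This
is where it matters that there is only one existential variable of each type.
-/

namespace TST

open Formula

/-! ### Renaming of variables -/

namespace Renaming

theorem lift_comp (m : ℕ) (σ ρ : Renaming) :
    (fun n i => σ.lift m n (ρ.lift m n i)) = lift m (fun n i => σ n (ρ n i)) := by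
  funext n i
  by_cases h : n = m
  · subst h; cases i <;> simp [lift]
  · simp [lift, h]

theorem lift_shift (m : ℕ) (ρ : Renaming) :
    (fun n i => ρ.lift m n (shift m n i)) = fun n i => shift m n (ρ n i) := by
  funext n i
  by_cases h : n = m
  · subst h; simp [lift, shift]
  · simp [lift, shift, h]

theorem inst_lift (m k : ℕ) (ρ : Renaming) :
    (fun n i => inst m k n (ρ.lift m n i)) =
      fun n i => if n = m then Nat.casesOn i k (fun j => ρ n j) else ρ n i := by
  funext n i
  by_cases h : n = m
  · subst h; cases i <;> simp [lift, inst]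
  · simp [lift, inst, h]

theorem comp_inst (m k : ℕ) (ρ : Renaming) :
    (fun n i => ρ n (inst m k n i)) = fun n i => inst m (ρ m k) n (ρ.lift m n i) := by
  funext n i
  by_cases h : n = m
  · subst h; cases i <;> simp [lift, inst]
  · simp [lift, inst, h]

end Renaming

namespace Formula

theorem rename_rename (σ ρ : Renaming) (φ : Formula) :
    rename σ (rename ρ φ) = rename (fun n i => σ n (ρ n i)) φ := by
  induction φ generalizing σ ρ with
  | eq | mem | bot => rfl
  | imp φ ψ ihφ ihψ => simp only [rename, ihφ, ihψ]
  | all m φ ih => simp only [rename, ih, Renaming.lift_comp]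

theorem rename_congr {σ ρ : Renaming} {φ : Formula}
    (h : ∀ n i, φ.IsFree n i → σ n i = ρ n i) : rename σ φ = rename ρ φ := by
  induction φ generalizing σ ρ with
  | eq m a b => simp only [rename, h m a (by simp [IsFree]), h m b (by simp [IsFree])]
  | mem m a b => simp only [rename, h m a (by simp [IsFree]), h (m + 1) b (by simp [IsFree])]
  | bot => rfl
  | imp φ ψ ihφ ihψ =>
    simp only [rename, ihφ fun n i hi => h n i (.inl hi), ihψ fun n i hi => h n i (.inr hi)]
  | all m φ ih =>
    simp only [rename]
    rw [ih]
    intro n i hi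
    by_cases hn : n = m
    · subst hn
      cases i with
      | zero => simp [Renaming.lift]
      | succ j => simpa [Renaming.lift] using h n j (by simpa [IsFree] using hi)
    · simpa [Renaming.lift, hn] using h n i (by simpa [IsFree, hn] using hi)

theorem rename_id (φ : Formula) : rename (fun _ i => i) φ = φ := by
  induction φ with
  | eq | mem | bot => rfl
  | imp φ ψ ihφ ihψ => simp only [rename, ihφ, ihψ]
  | all m φ ih =>
    have : Renaming.lift m (fun _ i => i) = fun _ i => i := by
      funext n i
      cases i <;> simp [Renaming.lift]
    simp only [rename, this, ih]

theorem IsSentence.rename_eq {φ : Formula} (h : φ.IsSentence) (ρ : Renaming) :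
    rename ρ φ = φ := by
  rw [rename_congr (ρ := fun _ i => i) fun n i hi => (h n i hi).elim, rename_id]

theorem exists_bound (φ : Formula) : ∃ B, ∀ n i, φ.IsFree n i → n < B ∧ i < B := by
  induction φ with
  | eq m a b =>
    refine ⟨m + a + b + 1, fun n i h => ?_⟩
    simp only [IsFree] at h; omega
  | mem m a b =>
    refine ⟨m + a + b + 2, fun n i h => ?_⟩
    simp only [IsFree] at h; omega
  | bot => exact ⟨0, fun n i h => h.elim⟩
  | imp φ ψ ihφ ihψ =>
    obtain ⟨B, hB⟩ := ihφ
    obtain ⟨C, hC⟩ := ihψ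
    refine ⟨B + C, fun n i h => ?_⟩
    rcases h with h | h
    · have := hB n i h; omega
    · have := hC n i h; omega
  | all m φ ih =>
    obtain ⟨B, hB⟩ := ih
    refine ⟨B, fun n i h => ?_⟩
    have := hB _ _ h
    split_ifs at this <;> omega

theorem exists_fresh (Γ : List Formula) (φ : Formula) (n : ℕ) :
    ∃ k, ¬ φ.IsFree n k ∧ ∀ ψ ∈ Γ, ¬ ψ.IsFree n k := by
  choose B hB using exists_bound
  have hΓ : ∃ C, ∀ ψ ∈ Γ, B ψ ≤ C :=
    ⟨(Γ.map B).sum, fun ψ hψ => List.le_sum_of_mem (List.mem_map_of_mem hψ)⟩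
  obtain ⟨C, hC⟩ := hΓ
  refine ⟨B φ + C, fun h => ?_, fun ψ hψ h => ?_⟩
  · have := (hB _ _ _ h).2; omega
  · have := (hB _ _ _ h).2
    have := hC ψ hψ
    omega

/-- An injective coding of formulas by natural numbers. -/
def code : Formula → ℕ
  | eq n i j => 5 * Nat.pair n (Nat.pair i j)
  | mem n i j => 5 * Nat.pair n (Nat.pair i j) + 1
  | bot => 2
  | imp φ ψ => 5 * Nat.pair (code φ) (code ψ) + 3
  | all n φ => 5 * Nat.pair n (code φ) + 4

theorem code_injective : Function.Injective code := by
  intro φ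
  induction φ with
  | eq | mem | bot =>
    intro ψ h
    cases ψ <;> simp only [code] at h <;> try omega
    all_goals first
      | rfl
      | (rename_i n i j n' i' j'
         have h' : Nat.pair n (Nat.pair i j) = Nat.pair n' (Nat.pair i' j') := by omega
         simp only [Nat.pair_eq_pair] at h'
         obtain ⟨rfl, rfl, rfl⟩ := h'
         rfl)
  | imp φ φ' ih ih' =>
    intro ψ h
    cases ψ <;> simp only [code] at h <;> try omega
    rename_i ψ ψ'
    have h' : Nat.pair (code φ) (code φ') = Nat.pair (code ψ) (code ψ') := by omega
    rw [Nat.pair_eq_pair] at h'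
    rw [ih h'.1, ih' h'.2]
  | all n φ ih =>
    intro ψ h
    cases ψ <;> simp only [code] at h <;> try omega
    rename_i m ψ
    have h' : Nat.pair n (code φ) = Nat.pair m (code ψ) := by omega
    rw [Nat.pair_eq_pair] at h'
    rw [h'.1, ih h'.2]

instance : Countable Formula := code_injective.countable

instance : Nonempty Formula := ⟨bot⟩

end Formula

/-! ### Derivability from sets of formulas -/

theorem Derives.weaken {Γ Δ : List Formula} {φ : Formula} (h : Derives Γ φ) (hΓ : Γ ⊆ Δ) :
    Derives Δ φ := by
  induction h generalizing Δ with
  | assumption h => exact .assumption (hΓ h)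
  | impIntro _ ih => exact .impIntro (ih (List.cons_subset_cons _ hΓ))
  | impElim _ _ ih ih' => exact .impElim (ih hΓ) (ih' hΓ)
  | byContradiction _ ih => exact .byContradiction (ih (List.cons_subset_cons _ hΓ))
  | allIntro _ ih => exact .allIntro (ih (List.map_subset _ hΓ))
  | allElim i _ ih => exact .allElim i (ih hΓ)
  | eqRefl n i => exact .eqRefl n i
  | eqSubst φ _ _ ih ih' => exact .eqSubst φ (ih hΓ) (ih' hΓ)

theorem Formula.rename_rename_inst (ρ : Renaming) (n i : ℕ) (φ : Formula) :
    rename ρ (rename (Renaming.inst n i) φ) =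
      rename (Renaming.inst n (ρ n i)) (rename (ρ.lift n) φ) := by
  rw [rename_rename, rename_rename, Renaming.comp_inst]

theorem Derives.rename {Γ : List Formula} {φ : Formula} (h : Derives Γ φ) (ρ : Renaming) :
    Derives (Γ.map (rename ρ)) (rename ρ φ) := by
  induction h generalizing ρ with
  | assumption h => exact .assumption (List.mem_map_of_mem h)
  | impIntro _ ih => exact .impIntro (ih ρ)
  | impElim _ _ ih ih' => exact .impElim (ih ρ) (ih' ρ)
  | byContradiction _ ih => exact .byContradiction (ih ρ)
  | @allIntro Γ n φ _ ih =>
    refine .allIntro ?_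
    have := ih (ρ.lift n)
    rw [List.map_map] at this ⊢
    convert this using 2
    funext ψ
    simp only [Function.comp_apply, rename_rename, Renaming.lift_shift]
  | @allElim Γ n φ i _ ih =>
    rw [rename_rename_inst]
    exact .allElim _ (ih ρ)
  | eqRefl n i => exact .eqRefl n _
  | @eqSubst Γ n i j φ _ _ ih ih' =>
    rw [rename_rename_inst]
    refine .eqSubst _ (ih ρ) ?_
    rw [← rename_rename_inst]
    exact ih' ρ

/-- Generalization on a variable `k` that does not occur free in the assumptions. -/
theorem Derives.generalize {Γ : List Formula} {n k : ℕ} {φ : Formula}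
    (h : Derives Γ (Formula.rename (Renaming.inst n k) φ)) (hφ : ¬ (all n φ).IsFree n k)
    (hΓ : ∀ ψ ∈ Γ, ¬ ψ.IsFree n k) : Derives Γ (all n φ) := by
  -- `ρ` renames `k` to the new bound variable and makes room for it everywhere else.
  let ρ : Renaming := fun m i => if m = n then (if i = k then 0 else i + 1) else i
  have h' := h.rename ρ
  refine .allIntro ?_
  have e₁ : Γ.map (Formula.rename ρ) = Γ.map (Formula.rename (Renaming.shift n)) := by
    refine List.map_congr_left fun ψ hψ => rename_congr fun m i hi => ?_
    by_cases hm : m = n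
    · subst hm
      have : i ≠ k := fun e => hΓ ψ hψ (e ▸ hi)
      simp [ρ, Renaming.shift, this]
    · simp [ρ, Renaming.shift, hm]
  have e₂ : Formula.rename ρ (Formula.rename (Renaming.inst n k) φ) = φ := by
    rw [rename_rename]
    conv_rhs => rw [← rename_id φ]
    refine rename_congr fun m i hi => ?_
    by_cases hm : m = n
    · subst hm
      cases i with
      | zero => simp [ρ, Renaming.inst]
      | succ j =>
        have : j ≠ k := by
          rintro rfl
          exact hφ (by simpa [IsFree] using hi)
        simp [ρ, Renaming.inst, this]
    · simp [ρ, Renaming.inst, hm]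
  rwa [e₁, e₂] at h'

namespace Proves

theorem mono {T U : Set Formula} {φ : Formula} (h : Proves T φ) (hTU : T ⊆ U) : Proves U φ := by
  obtain ⟨Γ, hΓ, h⟩ := h
  exact ⟨Γ, fun ψ hψ => hTU (hΓ ψ hψ), h⟩

theorem of_mem {T : Set Formula} {φ : Formula} (h : φ ∈ T) : Proves T φ :=
  ⟨[φ], by simpa using h, .assumption (by simp)⟩

theorem of_derives {T : Set Formula} {φ : Formula} (h : Derives [] φ) : Proves T φ :=
  ⟨[], by simp, h⟩

theorem mp {T : Set Formula} {φ ψ : Formula} (h : Proves T (imp φ ψ)) (h' : Proves T φ) :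
    Proves T ψ := by
  obtain ⟨Γ, hΓ, h⟩ := h
  obtain ⟨Δ, hΔ, h'⟩ := h'
  refine ⟨Γ ++ Δ, fun χ hχ => ?_,
    .impElim (h.weaken (List.subset_append_left _ _)) (h'.weaken (List.subset_append_right _ _))⟩
  rcases List.mem_append.1 hχ with hχ | hχ
  exacts [hΓ χ hχ, hΔ χ hχ]

theorem exists_cons {T : Set Formula} {φ ψ : Formula} (h : Proves (insert φ T) ψ) :
    ∃ Γ : List Formula, (∀ χ ∈ Γ, χ ∈ T) ∧ Derives (φ :: Γ) ψ := by
  classical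
  obtain ⟨Γ, hΓ, h⟩ := h
  refine ⟨Γ.filter (fun χ => χ ≠ φ), fun χ hχ => ?_, h.weaken fun χ hχ => ?_⟩
  · simp only [ne_eq, decide_not, List.mem_filter, Bool.not_eq_eq_eq_not, Bool.not_true,
      decide_eq_false_iff_not] at hχ
    exact (hΓ χ hχ.1).resolve_left hχ.2
  · by_cases e : χ = φ <;> simp [e, hχ]

theorem impIntro {T : Set Formula} {φ ψ : Formula} (h : Proves (insert φ T) ψ) :
    Proves T (imp φ ψ) := by
  obtain ⟨Γ, hΓ, h⟩ := exists_cons h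
  exact ⟨Γ, hΓ, .impIntro h⟩

theorem byContradiction {T : Set Formula} {φ : Formula} (h : Proves (insert (neg φ) T) bot) :
    Proves T φ := by
  obtain ⟨Γ, hΓ, h⟩ := exists_cons h
  exact ⟨Γ, hΓ, .byContradiction h⟩

theorem exfalso {T : Set Formula} {φ : Formula} (h : Proves T bot) : Proves T φ :=
  byContradiction (h.mono (Set.subset_insert _ _))

theorem allElim {T : Set Formula} {n : ℕ} {φ : Formula} (h : Proves T (all n φ)) (k : ℕ) :
    Proves T (rename (Renaming.inst n k) φ) := by
  obtain ⟨Γ, hΓ, h⟩ := h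
  exact ⟨Γ, hΓ, .allElim k h⟩

theorem eqSubst {T : Set Formula} {n i j : ℕ} (φ : Formula) (h : Proves T (eq n i j))
    (h' : Proves T (rename (Renaming.inst n i) φ)) :
    Proves T (rename (Renaming.inst n j) φ) := by
  obtain ⟨Γ, hΓ, h⟩ := h
  obtain ⟨Δ, hΔ, h'⟩ := h'
  refine ⟨Γ ++ Δ, fun χ hχ => ?_, .eqSubst φ (h.weaken (List.subset_append_left _ _))
    (h'.weaken (List.subset_append_right _ _))⟩
  rcases List.mem_append.1 hχ with hχ | hχ
  exacts [hΓ χ hχ, hΔ χ hχ]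

theorem generalize {T : Set Formula} {n k : ℕ} {φ : Formula}
    (h : Proves T (rename (Renaming.inst n k) φ)) (hφ : ¬ (all n φ).IsFree n k)
    (hT : ∀ ψ ∈ T, ¬ ψ.IsFree n k) : Proves T (all n φ) := by
  obtain ⟨Γ, hΓ, h⟩ := h
  exact ⟨Γ, hΓ, h.generalize hφ fun ψ hψ => hT ψ (hΓ ψ hψ)⟩

end Proves

/-! ### Maximal consistent sets with witnesses -/

/-- A set of formulas that does not derive falsity. -/
def Consistent (T : Set Formula) : Prop := ¬ Proves T bot

theorem isOfFiniteCharacter_consistent : Order.IsOfFiniteCharacter {T | Consistent T} := by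
  intro T
  constructor
  · exact fun h U hU _ hbot => h (Proves.mono hbot hU)
  · rintro h ⟨Γ, hΓ, hd⟩
    exact h {ψ | ψ ∈ Γ} hΓ Γ.finite_toSet ⟨Γ, fun _ h => h, hd⟩

/-- The formula `φ(k) → ∀ xⁿ φ(x)`, which makes the variable `k` a witness for the failure of
`∀ xⁿ φ(x)`. -/
def henkin (n k : ℕ) (φ : Formula) : Formula := imp (rename (Renaming.inst n k) φ) (all n φ)

/-- If `T` refutes `φ(k) → ∀ xⁿ φ(x)`, it derives `φ(k)` and `¬ ∀ xⁿ φ(x)`; as `k` is new, this is a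
contradiction. -/
theorem Consistent.insert_henkin {T : Set Formula} (hT : Consistent T) {n k : ℕ} {φ : Formula}
    (hφ : ¬ (all n φ).IsFree n k) (hk : ∀ ψ ∈ T, ¬ ψ.IsFree n k) :
    Consistent (insert (henkin n k φ) T) := by
  intro h
  have h₁ : Proves T (neg (henkin n k φ)) := h.impIntro
  have h₂ : Proves T (neg (all n φ)) := by
    refine Proves.impIntro (Proves.mp (h₁.mono (Set.subset_insert _ _)) (Proves.impIntro ?_))
    exact Proves.of_mem (by simp)
  refine hT (h₂.mp (Proves.generalize (k := k) (Proves.byContradiction ?_) hφ hk))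
  refine Proves.mp (h₁.mono (Set.subset_insert _ _)) (Proves.impIntro (Proves.exfalso ?_))
  exact Proves.mp (Proves.of_mem (φ := neg (rename (Renaming.inst n k) φ)) (by simp))
    (Proves.of_mem (by simp))

/-- A consistent set of sentences has a consistent extension with a witness for every universal
formula: all variables are available as witnesses, because none is free in a sentence. -/
theorem Consistent.exists_henkin {T : Set Formula} (hT : Consistent T)
    (hs : ∀ φ ∈ T, φ.IsSentence) :
    ∃ U, T ⊆ U ∧ Consistent U ∧ ∀ n φ, ∃ k, henkin n k φ ∈ U := by
  obtain ⟨e, he⟩ := exists_surjective_nat (ℕ × Formula)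
  choose k hk hkΓ using fun (Γ : List Formula) (p : ℕ × Formula) =>
    exists_fresh Γ (all p.1 p.2) p.1
  let Γ : ℕ → List Formula := fun i =>
    Nat.rec [] (fun i Γ => henkin (e i).1 (k Γ (e i)) (e i).2 :: Γ) i
  have hΓ : ∀ i, Γ (i + 1) = henkin (e i).1 (k (Γ i) (e i)) (e i).2 :: Γ i := fun i => rfl
  have hmono : Monotone fun i => {ψ | ψ ∈ Γ i} := by
    refine monotone_nat_of_le_succ fun i ψ hψ => ?_
    simp only [Set.mem_ofPred_eq] at hψ ⊢
    rw [hΓ]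
    exact List.mem_cons_of_mem _ hψ
  have hcon : ∀ i, Consistent (T ∪ {ψ | ψ ∈ Γ i}) := by
    intro i
    induction i with
    | zero => simpa [Γ] using hT
    | succ i ih =>
      have : T ∪ {ψ | ψ ∈ Γ (i + 1)} =
          insert (henkin (e i).1 (k (Γ i) (e i)) (e i).2) (T ∪ {ψ | ψ ∈ Γ i}) := by
        ext ψ
        simp only [hΓ, List.mem_cons, Set.mem_union, Set.mem_ofPred_eq, Set.mem_insert_iff]
        tauto
      rw [this]
      refine ih.insert_henkin (hk _ _) fun ψ hψ => ?_
      rcases hψ with hψ | hψ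
      exacts [hs ψ hψ _ _, hkΓ _ _ ψ hψ]
  refine ⟨⋃ i, T ∪ {ψ | ψ ∈ Γ i}, fun ψ hψ => Set.mem_iUnion.2 ⟨0, .inl hψ⟩, ?_, fun n φ => ?_⟩
  · rintro ⟨Δ, hΔ, hd⟩
    have : ∃ i, ∀ ψ ∈ Δ, ψ ∈ T ∪ {ψ | ψ ∈ Γ i} := by
      clear hd
      induction Δ with
      | nil => exact ⟨0, by simp⟩
      | cons χ Δ ih =>
        obtain ⟨i, hi⟩ := ih fun ψ hψ => hΔ ψ (List.mem_cons_of_mem _ hψ)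
        obtain ⟨j, hj⟩ := Set.mem_iUnion.1 (hΔ χ List.mem_cons_self)
        refine ⟨max i j, fun ψ hψ => ?_⟩
        rcases List.mem_cons.1 hψ with rfl | hψ
        · exact Set.union_subset_union_right T (hmono (le_max_right i j)) hj
        · exact Set.union_subset_union_right T (hmono (le_max_left i j)) (hi ψ hψ)
    obtain ⟨i, hi⟩ := this
    exact hcon i ⟨Δ, hi, hd⟩
  · obtain ⟨i, hi⟩ := he (n, φ)
    refine ⟨k (Γ i) (e i), Set.mem_iUnion.2 ⟨i + 1, .inr ?_⟩⟩
    simp [hΓ, hi]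

/-- A maximal consistent set of formulas with a witness for every universal formula. -/
structure IsHenkin (H : Set Formula) : Prop where
  consistent : Consistent H
  mem_or_neg_mem : ∀ φ, φ ∈ H ∨ neg φ ∈ H
  exists_henkin : ∀ n φ, ∃ k, henkin n k φ ∈ H

theorem Consistent.exists_isHenkin {T : Set Formula} (hT : Consistent T)
    (hs : ∀ φ ∈ T, φ.IsSentence) : ∃ H, T ⊆ H ∧ IsHenkin H := by
  obtain ⟨U, hTU, hU, hw⟩ := hT.exists_henkin hs
  obtain ⟨H, hUH, hH⟩ := isOfFiniteCharacter_consistent.exists_maximal hU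
  refine ⟨H, hTU.trans hUH, hH.prop, fun φ => ?_, fun n φ => ?_⟩
  · by_contra! hc
    have aux : ∀ ψ, ψ ∉ H → Proves (insert ψ H) bot := fun ψ hψ => by
      by_contra hcon
      exact hψ (hH.le_of_ge (y := insert ψ H) hcon (Set.subset_insert _ _) (Set.mem_insert _ _))
    exact hH.prop ((aux _ hc.2).impIntro.mp (aux _ hc.1).impIntro)
  · obtain ⟨k, hk⟩ := hw n φ
    exact ⟨k, hUH hk⟩

namespace IsHenkin

variable {H : Set Formula}

theorem mem_of_proves (hH : IsHenkin H) {φ : Formula} (h : Proves H φ) : φ ∈ H :=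
  (hH.mem_or_neg_mem φ).resolve_right fun h' => hH.consistent ((Proves.of_mem h').mp h)

theorem bot_notMem (hH : IsHenkin H) : bot ∉ H := fun h => hH.consistent (Proves.of_mem h)

theorem imp_mem_iff (hH : IsHenkin H) {φ ψ : Formula} :
    imp φ ψ ∈ H ↔ (φ ∈ H → ψ ∈ H) := by
  refine ⟨fun h h' => hH.mem_of_proves ((Proves.of_mem h).mp (Proves.of_mem h')), fun h => ?_⟩
  refine hH.mem_of_proves (Proves.impIntro ?_)
  rcases hH.mem_or_neg_mem φ with h' | h'
  · exact Proves.of_mem (.inr (h h'))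
  · exact Proves.exfalso ((Proves.of_mem (.inr h')).mp (Proves.of_mem (.inl rfl)))

theorem all_mem_iff (hH : IsHenkin H) {n : ℕ} {φ : Formula} :
    all n φ ∈ H ↔ ∀ k, rename (Renaming.inst n k) φ ∈ H := by
  refine ⟨fun h k => hH.mem_of_proves ((Proves.of_mem h).allElim k), fun h => ?_⟩
  obtain ⟨k, hk⟩ := hH.exists_henkin n φ
  exact hH.imp_mem_iff.1 hk (h k)

theorem eq_refl (hH : IsHenkin H) (n i : ℕ) : eq n i i ∈ H :=
  hH.mem_of_proves (Proves.of_derives (.eqRefl n i))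

theorem eq_subst (hH : IsHenkin H) {n i j : ℕ} (h : eq n i j ∈ H) (φ : Formula)
    (h' : rename (Renaming.inst n i) φ ∈ H) : rename (Renaming.inst n j) φ ∈ H :=
  hH.mem_of_proves ((Proves.of_mem h).eqSubst φ (Proves.of_mem h'))

theorem eq_symm (hH : IsHenkin H) {n i j : ℕ} (h : eq n i j ∈ H) : eq n j i ∈ H := by
  have := hH.eq_subst h (eq n 0 (i + 1))
  simp only [rename, Renaming.inst, if_true] at this
  exact this (hH.eq_refl n i)

theorem eq_trans (hH : IsHenkin H) {n i j k : ℕ} (h : eq n i j ∈ H) (h' : eq n j k ∈ H) :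
    eq n i k ∈ H := by
  have := hH.eq_subst h' (eq n (i + 1) 0)
  simp only [rename, Renaming.inst, if_true] at this
  exact this h

theorem mem_congr (hH : IsHenkin H) {n i i' j j' : ℕ} (hi : eq n i i' ∈ H)
    (hj : eq (n + 1) j j' ∈ H) (h : mem n i j ∈ H) : mem n i' j' ∈ H := by
  have h₁ := hH.eq_subst hi (mem n 0 j)
  have h₂ := hH.eq_subst hj (mem n i' 0)
  simp only [rename, Renaming.inst, if_true, Nat.succ_ne_self, Nat.ne_add_one,
    if_false] at h₁ h₂
  exact h₂ (h₁ h)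

end IsHenkin

/-! ### Satisfaction and the completeness theorem -/

/-- A structure for the language of type theory: a domain for each type and a membership relation
between consecutive types.  Equality is interpreted by equality. -/
structure Model where
  /-- The objects of type `n`. -/
  Obj : ℕ → Type
  /-- Membership of objects of type `n` in objects of type `n + 1`. -/
  Mem : ∀ {n}, Obj n → Obj (n + 1) → Prop

namespace Model

/-- An assignment of objects to the variables of each type. -/
abbrev Valuation (M : Model) : Type := ∀ n, ℕ → M.Obj n

/-- The valuation below a quantifier of type `n` whose variable denotes `a`. -/
def push {M : Model} (n : ℕ) (a : M.Obj n) (v : M.Valuation) : M.Valuation :=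
  Function.update v n fun i => Nat.casesOn i a (v n)

/-- Satisfaction of a formula under a valuation. -/
def Sat (M : Model) : Formula → M.Valuation → Prop
  | eq n i j, v => v n i = v n j
  | mem n i j, v => M.Mem (v n i) (v (n + 1) j)
  | bot, _ => False
  | imp φ ψ, v => Sat M φ v → Sat M ψ v
  | all n φ, v => ∀ a : M.Obj n, Sat M φ (push n a v)

end Model

/-- Provable equality of variables of type `n`. -/
def IsHenkin.setoid {H : Set Formula} (hH : IsHenkin H) (n : ℕ) : Setoid ℕ where
  r i j := eq n i j ∈ H
  iseqv := ⟨hH.eq_refl n, hH.eq_symm, hH.eq_trans⟩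

/-- The term model of `H`: the objects of type `n` are the variables of type `n` modulo provable
equality. -/
def IsHenkin.model {H : Set Formula} (hH : IsHenkin H) : Model where
  Obj n := Quotient (hH.setoid n)
  Mem {n} := Quotient.lift₂ (fun i j => mem n i j ∈ H) fun _ _ _ _ hi hj =>
    propext ⟨hH.mem_congr hi hj, hH.mem_congr (hH.eq_symm hi) (hH.eq_symm hj)⟩

/-- The object denoted by the variable `i` of type `n` in the term model. -/
def IsHenkin.var {H : Set Formula} (hH : IsHenkin H) (n i : ℕ) : hH.model.Obj n :=
  Quotient.mk (hH.setoid n) i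

theorem IsHenkin.var_surjective {H : Set Formula} (hH : IsHenkin H) (n : ℕ) :
    Function.Surjective (hH.var n) :=
  Quotient.mk_surjective

theorem IsHenkin.sat_iff {H : Set Formula} (hH : IsHenkin H) (φ : Formula) (ρ : Renaming) :
    hH.model.Sat φ (fun n i => hH.var n (ρ n i)) ↔ rename ρ φ ∈ H := by
  induction φ generalizing ρ with
  | eq n i j => exact Quotient.eq (r := hH.setoid n)
  | mem n i j => exact Iff.rfl
  | bot => exact ⟨False.elim, hH.bot_notMem⟩
  | imp φ ψ ihφ ihψ =>
    simp only [Model.Sat, rename, hH.imp_mem_iff, ihφ, ihψ]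
  | all n φ ih =>
    simp only [Model.Sat, rename, hH.all_mem_iff, rename_rename, Renaming.inst_lift]
    rw [(hH.var_surjective n).forall]
    refine forall_congr' fun k => ?_
    rw [← ih]
    refine iff_of_eq (congrArg _ ?_)
    funext m
    by_cases hm : m = n
    · subst hm
      funext i
      cases i <;> simp [Model.push]
    · simp [Model.push, hm]

/-- Completeness: a consistent set of sentences has a model. -/
theorem Consistent.exists_model {T : Set Formula} (hT : Consistent T)
    (hs : ∀ φ ∈ T, φ.IsSentence) :
    ∃ M : Model, Nonempty M.Valuation ∧ ∀ φ ∈ T, ∀ v, M.Sat φ v := by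
  obtain ⟨H, hTH, hH⟩ := hT.exists_isHenkin hs
  refine ⟨hH.model, ⟨hH.var⟩, fun φ hφ v => ?_⟩
  choose ρ hρ using fun n i => hH.var_surjective n (v n i)
  have := (hH.sat_iff φ ρ).2 (by rw [(hs φ hφ).rename_eq]; exact hTH hφ)
  simpa only [hρ] using this

/-! ### Models of type theory with infinity -/

namespace Formula

theorem isFree_allBlock (z : List ℕ) (φ : Formula) (n i : ℕ) :
    (allBlock z φ).IsFree n i ↔ φ.IsFree n (i + z.count n) := by
  induction z generalizing i with
  | nil => rfl
  | cons m z ih =>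
    change (allBlock z φ).IsFree n (if n = m then i + 1 else i) ↔ _
    rw [ih, List.count_cons]
    by_cases h : n = m
    · subst h; simp [add_assoc, add_comm 1]
    · simp [h, Ne.symm h]

theorem exists_isSentence_allBlock (φ : Formula) : ∃ z, (allBlock z φ).IsSentence := by
  obtain ⟨B, hB⟩ := exists_bound φ
  refine ⟨(List.range B).flatMap (List.replicate B), fun n i h => ?_⟩
  rw [isFree_allBlock] at h
  obtain ⟨hn, hi⟩ := hB _ _ h
  have : B ≤ ((List.range B).flatMap (List.replicate B)).count n := by
    have hsub : List.Sublist (List.replicate B n) ((List.range B).flatMap (List.replicate B)) :=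
      List.sublist_flatten_of_mem (List.mem_map_of_mem (List.mem_range.2 hn))
    simpa using hsub.count_le n
  omega

end Formula

theorem isSentence_of_mem_theoryTSTI {φ : Formula} (h : φ ∈ theoryTSTI) : φ.IsSentence := by
  rcases h with rfl | ⟨m, rfl⟩ | ⟨_, _, _, rfl, h⟩
  · intro n i h
    rcases n with _ | _ | _ | _ | n <;>
      simp [infinity, relOn, totalOn, functional, injective, notSurjective, pairMem, isPair, ex,
        conj, disj, bicond, neg, IsFree] at h
  · intro n i h
    by_cases h₁ : n = m + 1 <;> by_cases h₂ : n = m <;>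
      simp [extensionality, bicond, conj, neg, IsFree, h₁, h₂] at h
  · exact h

namespace Model

variable {M : Model}

@[simp] theorem push_zero (n : ℕ) (a : M.Obj n) (v : M.Valuation) : push n a v n 0 = a := by
  simp [push]

@[simp] theorem push_succ (n i : ℕ) (a : M.Obj n) (v : M.Valuation) :
    push n a v n (i + 1) = v n i := by
  simp [push]

@[simp] theorem push_one (n : ℕ) (a : M.Obj n) (v : M.Valuation) : push n a v n 1 = v n 0 :=
  push_succ n 0 a v

@[simp] theorem push_two (n : ℕ) (a : M.Obj n) (v : M.Valuation) : push n a v n 2 = v n 1 :=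
  push_succ n 1 a v

theorem push_of_ne {n m : ℕ} (h : m ≠ n) (a : M.Obj n) (v : M.Valuation) :
    push n a v m = v m := by
  simp [push, h]

@[simp] theorem push_self_add_one (n i : ℕ) (a : M.Obj n) (v : M.Valuation) :
    push n a v (n + 1) i = v (n + 1) i := by
  simp [push]

@[simp] theorem push_add_one_self (n i : ℕ) (a : M.Obj (n + 1)) (v : M.Valuation) :
    push (n + 1) a v n i = v n i := by
  simp [push]

theorem exists_eq_push (n : ℕ) (v : M.Valuation) : ∃ w : M.Valuation, v = push n (v n 0) w := by
  refine ⟨Function.update v n fun i => v n (i + 1), ?_⟩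
  funext m i
  by_cases h : m = n
  · subst h; cases i <;> simp [push]
  · simp [push, h]

@[simp] theorem sat_neg {φ : Formula} {v : M.Valuation} : M.Sat (neg φ) v ↔ ¬ M.Sat φ v := Iff.rfl

@[simp] theorem sat_conj {φ ψ : Formula} {v : M.Valuation} :
    M.Sat (conj φ ψ) v ↔ M.Sat φ v ∧ M.Sat ψ v := by
  simp [conj, neg, Sat]

@[simp] theorem sat_disj {φ ψ : Formula} {v : M.Valuation} :
    M.Sat (disj φ ψ) v ↔ M.Sat φ v ∨ M.Sat ψ v := by
  simp [disj, neg, Sat]; tauto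

@[simp] theorem sat_bicond {φ ψ : Formula} {v : M.Valuation} :
    M.Sat (bicond φ ψ) v ↔ (M.Sat φ v ↔ M.Sat ψ v) := by
  simp [bicond, Sat]; tauto

@[simp] theorem sat_ex {n : ℕ} {φ : Formula} {v : M.Valuation} :
    M.Sat (ex n φ) v ↔ ∃ a, M.Sat φ (push n a v) := by
  simp [ex, neg, Sat]

theorem sat_rename (φ : Formula) (ρ : Renaming) (v : M.Valuation) :
    M.Sat (rename ρ φ) v ↔ M.Sat φ (fun n i => v n (ρ n i)) := by
  induction φ generalizing ρ v with
  | eq | mem | bot => rfl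
  | imp φ ψ ihφ ihψ => simp only [rename, Sat, ihφ, ihψ]
  | all n φ ih =>
    simp only [rename, Sat, ih]
    refine forall_congr' fun a => iff_of_eq (congrArg _ ?_)
    funext m i
    by_cases h : m = n
    · subst h; cases i <;> simp [push, Renaming.lift]
    · simp [push, Renaming.lift, h]

theorem sat_of_sat_allBlock {z : List ℕ} {φ : Formula} (h : ∀ v, M.Sat (allBlock z φ) v)
    (v : M.Valuation) : M.Sat φ v := by
  induction z with
  | nil => exact h v
  | cons n z ih =>
    refine ih fun v => ?_
    obtain ⟨w, hw⟩ := exists_eq_push n v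
    rw [hw]
    exact h w _

theorem sat_allBlock {z : List ℕ} {φ : Formula} (h : ∀ v, M.Sat φ v) (v : M.Valuation) :
    M.Sat (allBlock z φ) v := by
  induction z generalizing v with
  | nil => exact h v
  | cons n z ih => exact fun a => ih _

/-- A property of the objects of type `n` is a set of `M` if it is the extension of an object of
type `n + 1`. -/
def IsSet (M : Model) {n : ℕ} (P : M.Obj n → Prop) : Prop :=
  ∃ y : M.Obj (n + 1), ∀ x, M.Mem x y ↔ P x

/-- The consequences of `TSTI` on which the argument depends: extensionality, the sets that exist
by quantifier-free comprehension, and infinitely many objects of type `0`. -/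
structure IsTypeTheory (M : Model) : Prop where
  ext : ∀ {n} (x y : M.Obj (n + 1)), (∀ z, M.Mem z x ↔ M.Mem z y) → x = y
  isSet_false : ∀ n, M.IsSet fun _ : M.Obj n => False
  isSet_imp : ∀ {n} {P Q : M.Obj n → Prop}, M.IsSet P → M.IsSet Q → M.IsSet fun x => P x → Q x
  isSet_eq : ∀ {n} (a : M.Obj n), M.IsSet fun x => x = a
  isSet_mem : ∀ {n} (a : M.Obj n), M.IsSet fun x => M.Mem a x
  infinite : Infinite (M.Obj 0)

/-- Comprehension in models of `TSTI`. -/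
theorem isSet_of_sat (hM : ∀ φ ∈ theoryTSTI, ∀ v, M.Sat φ v) {n : ℕ} (φ : Formula)
    (v : M.Valuation) : M.IsSet fun x : M.Obj n => M.Sat φ (push n x v) := by
  obtain ⟨z, hz⟩ := exists_isSentence_allBlock (comprehension n φ)
  have h := sat_of_sat_allBlock (hM _ (.inr (.inr ⟨n, φ, z, rfl, hz⟩))) v
  rw [comprehension, sat_ex] at h
  obtain ⟨y, hy⟩ := h
  refine ⟨y, fun x => ?_⟩
  have := hy x
  rw [sat_bicond, sat_rename] at this
  convert this using 2
  · simp [Sat]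
  · funext m i
    by_cases h₁ : m = n + 1
    · subst h₁; simp [Renaming.shift]
    · by_cases h₂ : m = n
      · subst h₂
        cases i <;> simp [Renaming.shift]
      · simp [push, Renaming.shift, h₁, h₂]

/-- An injective map of a finite set to itself is surjective, which contradicts the axiom of
infinity if the type `0` is finite. -/
theorem infinite_of_sat_infinity {v : M.Valuation} (h : M.Sat infinity v) :
    Infinite (M.Obj 0) := by
  by_contra hfin
  rw [not_infinite_iff_finite] at hfin
  simp only [infinity, sat_ex, sat_conj] at h
  obtain ⟨x, f, ⟨-, htot, -⟩, hinj, hsurj⟩ := h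
  let R : M.Obj 0 → M.Obj 0 → Prop := fun a b => ∃ p : M.Obj 2,
    (∀ u : M.Obj 1, M.Mem u p ↔ (∀ z, M.Mem z u ↔ z = a) ∨ ∀ z, M.Mem z u ↔ z = a ∨ z = b) ∧
      M.Mem p f
  replace htot : ∀ a, M.Mem a x → ∃ b, M.Mem b x ∧ R a b := by
    simpa [totalOn, pairMem, isPair, Sat, push_of_ne, R] using htot
  replace hinj : ∀ a b c, R a c → R b c → a = b := by
    intro a b c hac hbc
    have := hinj a b c
    simp [pairMem, isPair, Sat, push_of_ne] at this
    obtain ⟨p, hp, hpf⟩ := hac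
    obtain ⟨q, hq, hqf⟩ := hbc
    exact this p hp hpf q hq hqf
  replace hsurj : ∃ b, M.Mem b x ∧ ∀ a, M.Mem a x → ¬ R a b := by
    simpa [notSurjective, pairMem, isPair, Sat, push_of_ne, R] using hsurj
  choose g hgx hg using fun a : {a // M.Mem a x} => htot a.1 a.2
  have hg_inj : Function.Injective fun a => (⟨g a, hgx a⟩ : {a // M.Mem a x}) := by
    intro a b hab
    have hab' : g a = g b := congrArg Subtype.val hab
    exact Subtype.ext (hinj _ _ _ (hg a) (hab' ▸ hg b))
  obtain ⟨b, hb, hbR⟩ := hsurj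
  obtain ⟨a, ha⟩ := Finite.surjective_of_injective hg_inj ⟨b, hb⟩
  have hab : g a = b := congrArg Subtype.val ha
  exact hbR a.1 a.2 (hab ▸ hg a)

theorem isTypeTheory_of_sat (hM : ∀ φ ∈ theoryTSTI, ∀ v, M.Sat φ v) (v : M.Valuation) :
    M.IsTypeTheory where
  ext {n} x y h := by
    have := hM _ (.inr (.inl ⟨n, rfl⟩)) v x y
    simp only [sat_bicond, Sat, push_zero, push_succ, push_self_add_one] at this
    exact this.2 h
  isSet_false n := isSet_of_sat hM bot v
  isSet_imp {n P Q} := by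
    rintro ⟨y, hy⟩ ⟨z, hz⟩
    have := isSet_of_sat (n := n) hM (imp (mem n 0 0) (mem n 0 1))
      (push (n + 1) y (push (n + 1) z v))
    simpa only [Sat, push_zero, push_succ, push_self_add_one, hy, hz] using this
  isSet_eq {n} a := by
    simpa only [Sat, push_zero, push_succ] using isSet_of_sat (n := n) hM (eq n 0 1) (push n a v)
  isSet_mem {n} a := by
    simpa only [Sat, push_zero, push_add_one_self] using
      isSet_of_sat (n := n + 1) hM (mem n 0 0) (push n a v)
  infinite := infinite_of_sat_infinity (hM _ (.inl rfl) v)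

namespace IsTypeTheory

variable {n : ℕ} {P Q : M.Obj n → Prop}

theorem isSet_not (hM : M.IsTypeTheory) (hP : M.IsSet P) : M.IsSet fun x => ¬ P x :=
  hM.isSet_imp hP (hM.isSet_false n)

theorem isSet_or (hM : M.IsTypeTheory) (hP : M.IsSet P) (hQ : M.IsSet Q) :
    M.IsSet fun x => P x ∨ Q x := by
  simpa only [or_iff_not_imp_left] using hM.isSet_imp (hM.isSet_not hP) hQ

theorem isSet_and (hM : M.IsTypeTheory) (hP : M.IsSet P) (hQ : M.IsSet Q) :
    M.IsSet fun x => P x ∧ Q x := by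
  simpa only [not_or, not_not] using
    hM.isSet_not (hM.isSet_or (hM.isSet_not hP) (hM.isSet_not hQ))

theorem isSet_const (hM : M.IsTypeTheory) (n : ℕ) (p : Prop) : M.IsSet fun _ : M.Obj n => p := by
  by_cases hp : p
  · simpa [hp] using hM.isSet_not (hM.isSet_false n)
  · simpa [hp] using hM.isSet_false n

theorem isSet_iff (hM : M.IsTypeTheory) (hP : M.IsSet P) (p : Prop) :
    M.IsSet fun x => P x ↔ p := by
  by_cases hp : p
  · simpa [hp] using hP
  · simpa [hp] using hM.isSet_not hP

theorem isSet_exists_mem (hM : M.IsTypeTheory) {ι : Type*} {s : Set ι} (hs : s.Finite)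
    {P : ι → M.Obj n → Prop} (hP : ∀ i ∈ s, M.IsSet (P i)) : M.IsSet fun x => ∃ i ∈ s, P i x := by
  induction s, hs using Set.Finite.induction_on with
  | empty => simpa using hM.isSet_false n
  | @insert i s _ _ ih =>
    have := hM.isSet_or (hP i (.inl rfl)) (ih fun j hj => hP j (.inr hj))
    simpa [Set.mem_insert_iff, or_and_right, exists_or] using this

theorem isSet_forall_mem (hM : M.IsTypeTheory) {ι : Type*} {s : Set ι} (hs : s.Finite)
    {P : ι → M.Obj n → Prop} (hP : ∀ i ∈ s, M.IsSet (P i)) : M.IsSet fun x => ∀ i ∈ s, P i x := by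
  have := hM.isSet_not (hM.isSet_exists_mem hs fun i hi => hM.isSet_not (hP i hi))
  simpa only [not_exists, not_and, not_not] using this

theorem exists_of_finite (hM : M.IsTypeTheory) {s : Set (M.Obj n)} (hs : s.Finite) :
    ∃ y : M.Obj (n + 1), ∀ x, M.Mem x y ↔ x ∈ s := by
  have := hM.isSet_exists_mem hs fun a _ => hM.isSet_eq a
  simpa [IsSet] using this

end IsTypeTheory

/-! ### Matching finite parts of two models -/

section Matching

variable {M N : Model}

theorem IsTypeTheory.nonempty (hM : M.IsTypeTheory) (n : ℕ) : Nonempty (M.Obj n) := by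
  cases n with
  | zero => exact hM.infinite.nonempty
  | succ n => exact ⟨(hM.isSet_false n).choose⟩

/-- The members in `A n` tell apart the objects in `A (n + 1)`. -/
def IsExtensional (A : ∀ n, Set (M.Obj n)) : Prop :=
  ∀ n, ∀ a ∈ A (n + 1), ∀ b ∈ A (n + 1), (∀ z ∈ A n, M.Mem z a ↔ M.Mem z b) → a = b

theorem IsTypeTheory.exists_isExtensional (hM : M.IsTypeTheory) {A : ∀ n, Set (M.Obj n)}
    (hA : ∀ n, (A n).Finite) {B : ℕ} (hB : ∀ n, B ≤ n → A n = ∅) :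
    ∃ A' : ∀ n, Set (M.Obj n), (∀ n, A n ⊆ A' n) ∧ (∀ n, (A' n).Finite) ∧ IsExtensional A' := by
  have hw : ∀ n (a b : M.Obj (n + 1)), ∃ z, (M.Mem z a ↔ M.Mem z b) → a = b := by
    intro n a b
    by_contra! h
    obtain ⟨z⟩ := hM.nonempty n
    exact (h z).2 (hM.ext a b fun z => (h z).1)
  choose w hw using hw
  -- `D j n` adds the witnesses for the types above `n`, as far as type `n + j`.
  let D : ℕ → ∀ n, Set (M.Obj n) := fun j =>
    Nat.rec A (fun _ D n => A n ∪ Set.image2 (w n) (D (n + 1)) (D (n + 1))) j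
  have hD : ∀ j n, D (j + 1) n = A n ∪ Set.image2 (w n) (D j (n + 1)) (D j (n + 1)) :=
    fun _ _ => rfl
  have hfin : ∀ j n, (D j n).Finite := by
    intro j
    induction j with
    | zero => exact hA
    | succ j ih => exact fun n => (hA n).union ((ih _).image2 _ (ih _))
  refine ⟨fun n => D (B - n) n, fun n => ?_, fun n => hfin _ n, fun n a ha b hb h => ?_⟩
  · change A n ⊆ D (B - n) n
    rcases B - n with _ | j
    · exact Set.Subset.rfl
    · exact Set.subset_union_left
  · rcases le_or_gt B n with hn | hn
    · have : D (B - (n + 1)) (n + 1) = ∅ := by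
        rw [Nat.sub_eq_zero_of_le (by omega)]
        exact hB _ (by omega)
      exact absurd (this ▸ ha) (Set.notMem_empty a)
    · refine hw n a b (h _ ?_)
      have : B - n = (B - (n + 1)) + 1 := by omega
      simp only [this, hD]
      exact .inr (Set.mem_image2_of_mem ha hb)

/-- Infinitely many objects in an infinite set belong to the same elements of a finite set. -/
theorem exists_infinite_cell {n : ℕ} {C : Set (M.Obj n)} (hC : C.Infinite)
    {A : Set (M.Obj (n + 1))} (hA : A.Finite) :
    ∃ c : Set (M.Obj (n + 1)), {x ∈ C | ∀ a ∈ A, M.Mem x a ↔ a ∈ c}.Infinite := by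
  -- Otherwise `C` is the union of finitely many finite sets, one for each subset of `A`.
  by_contra! h
  refine hC ((hA.finite_subsets.biUnion fun c _ => h c).subset fun x hx => ?_)
  simp only [Set.mem_iUnion]
  exact ⟨{a ∈ A | M.Mem x a}, fun a ha => ha.1, hx, fun a ha => by simp [ha]⟩

open Classical in
/-- A choice of the elements of `A` to which infinitely many objects in the infinite set `C`
belong exactly. -/
noncomputable def cell {n : ℕ} (A : Set (M.Obj (n + 1))) (C : Set (M.Obj n)) :
    Set (M.Obj (n + 1)) :=
  if h : ∃ c : Set (M.Obj (n + 1)), {x ∈ C | ∀ a ∈ A, M.Mem x a ↔ a ∈ c}.Infinite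
  then h.choose else ∅

theorem infinite_cell {n : ℕ} {C : Set (M.Obj n)} (hC : C.Infinite)
    {A : Set (M.Obj (n + 1))} (hA : A.Finite) :
    {x ∈ C | ∀ a ∈ A, M.Mem x a ↔ a ∈ cell A C}.Infinite := by
  have h := exists_infinite_cell hC hA
  rw [cell, dif_pos h]
  exact h.choose_spec

/-- The part at type `n` of a matching between `M` and `N` over the finite sets `A n`: an injective
map on `A n`, and for each object `y` of `N`, an infinite set of objects of `M` outside `A n` which
may stand for `y` if `y` is not in the image of `A n`.  This set has to be definable from `y`, with
finitely many values. -/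
structure Stage (M N : Model) (A : ∀ n, Set (M.Obj n)) (n : ℕ) where
  /-- The map on `A n`; its values elsewhere are arbitrary. -/
  map : M.Obj n → N.Obj n
  /-- The objects of `M` that may stand for an object of `N`. -/
  cand : N.Obj n → Set (M.Obj n)
  injOn : Set.InjOn map (A n)
  infinite : ∀ y, (cand y).Infinite
  notMem : ∀ y, ∀ x ∈ cand y, x ∉ A n
  finite_range : (Set.range cand).Finite
  isSet : ∀ C, N.IsSet fun y => cand y = C

namespace Stage

variable {A : ∀ n, Set (M.Obj n)} {n : ℕ}

theorem exists_zero (hM : M.IsTypeTheory) (hN : N.IsTypeTheory) (hA : ∀ n, (A n).Finite) :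
    Nonempty (Stage M N A 0) := by
  have := hM.infinite
  have := hN.infinite
  obtain ⟨f, -, hf⟩ := (hA 0).exists_injOn_of_encard_le (t := (Set.univ : Set (N.Obj 0)))
    (by simp [Set.encard_univ])
  exact ⟨f, fun _ => (A 0)ᶜ, hf, fun _ => (hA 0).infinite_compl, fun _ _ h => h,
    Set.finite_range_const, fun C => hN.isSet_const 0 ((A 0)ᶜ = C)⟩

/-- The objects in `cand y` which belong to the elements of `A (n + 1)` chosen by `cell`, and to no
other elements of `A (n + 1)`. -/
def good (st : Stage M N A n) (y : N.Obj n) : Set (M.Obj n) :=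
  {x ∈ st.cand y | ∀ a ∈ A (n + 1), M.Mem x a ↔ a ∈ cell (A (n + 1)) (st.cand y)}

theorem infinite_good (st : Stage M N A n) (hA : ∀ n, (A n).Finite) (y : N.Obj n) :
    (st.good y).Infinite :=
  infinite_cell (st.infinite y) (hA _)

theorem finite_range_good (st : Stage M N A n) : (Set.range st.good).Finite := by
  refine (st.finite_range.image fun C : Set (M.Obj n) =>
    {x ∈ C | ∀ a ∈ A (n + 1), M.Mem x a ↔ a ∈ cell (A (n + 1)) C}).subset ?_
  rintro _ ⟨y, rfl⟩
  exact ⟨_, ⟨y, rfl⟩, rfl⟩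

/-- The extension of the image of `a` at the next type.  An object outside the image of `A n`
belongs to it or not according to the cell which contains its substitutes. -/
def NextMem (st : Stage M N A n) (a : M.Obj (n + 1)) (y : N.Obj n) : Prop :=
  (∃ z ∈ A n, M.Mem z a ∧ y = st.map z) ∨
    ((∀ z ∈ A n, y ≠ st.map z) ∧ a ∈ cell (A (n + 1)) (st.cand y))

theorem isSet_nextMem (st : Stage M N A n) (hN : N.IsTypeTheory) (hA : ∀ n, (A n).Finite)
    (a : M.Obj (n + 1)) : N.IsSet (st.NextMem a) := by
  refine hN.isSet_or (hN.isSet_exists_mem (hA n) fun z _ =>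
    hN.isSet_and (hN.isSet_const _ _) (hN.isSet_eq _)) (hN.isSet_and
    (hN.isSet_forall_mem (hA n) fun z _ => hN.isSet_not (hN.isSet_eq _)) ?_)
  have := hN.isSet_exists_mem st.finite_range (P := fun C y =>
    st.cand y = C ∧ a ∈ cell (A (n + 1)) C) fun C _ =>
      hN.isSet_and (st.isSet C) (hN.isSet_const _ _)
  simpa using this

/-- The objects of the next type outside `A (n + 1)` which contain the elements `t` of `A n` and no
others, and which split all of the sets `st.good y`. -/
def nextCand (st : Stage M N A n) (t : Set (M.Obj n)) : Set (M.Obj (n + 1)) :=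
  {x | x ∉ A (n + 1) ∧ (∀ a ∈ A n, M.Mem a x ↔ a ∈ t) ∧
    ∀ y, (∃ z ∈ st.good y, M.Mem z x) ∧ ∃ z ∈ st.good y, ¬ M.Mem z x}

/-- Infinitely many finite sets qualify: those that consist of `t`, one element of each set
`st.good y`, and one more element. -/
theorem infinite_nextCand (st : Stage M N A n) (hM : M.IsTypeTheory) (hN : N.IsTypeTheory)
    (hA : ∀ n, (A n).Finite) (t : Set (M.Obj n)) : (st.nextCand t).Infinite := by
  obtain ⟨y₀⟩ := hN.nonempty n
  have hgood : ∀ G ∈ Set.range st.good, ∃ p, p ∈ G := by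
    rintro _ ⟨y, rfl⟩
    exact (st.infinite_good hA y).nonempty
  obtain ⟨z₀⟩ := hM.nonempty n
  have : ∀ G, ∃ p, G ∈ Set.range st.good → p ∈ G := fun G => by
    by_cases hG : G ∈ Set.range st.good
    · exact (hgood G hG).imp fun p hp _ => hp
    · exact ⟨z₀, fun h => absurd h hG⟩
  choose p hp using this
  have hnotMem : ∀ y, ∀ z ∈ st.good y, z ∉ A n := fun y z hz => st.notMem y z hz.1
  let P : Set (M.Obj n) := p '' Set.range st.good
  have hPfin : P.Finite := st.finite_range_good.image p
  have hPA : ∀ z ∈ P, z ∉ A n := by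
    rintro _ ⟨_, ⟨y, rfl⟩, rfl⟩
    exact hnotMem y _ (hp _ ⟨y, rfl⟩)
  -- Each finite set `F ∪ {z}`, where `z` is in one good set and not in `F`, is a candidate unless it
  -- is one of the finitely many elements of `A (n + 1)`.
  let F : Set (M.Obj n) := {a ∈ A n | a ∈ t} ∪ P
  have hF : F.Finite := ((hA n).subset fun a ha => ha.1).union hPfin
  choose g hg using fun z : M.Obj n => hM.exists_of_finite (hF.insert z)
  have hinj : Set.InjOn g (st.good y₀ \ F) := by
    intro z hz z' _ h
    have : M.Mem z (g z') := h ▸ (hg z z).2 (.inl rfl)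
    exact ((hg z' z).1 this).resolve_right hz.2
  have hinf : (g '' (st.good y₀ \ F) \ A (n + 1)).Infinite :=
    (((st.infinite_good hA y₀).sdiff hF).image hinj).sdiff (hA _)
  refine hinf.mono ?_
  rintro _ ⟨⟨z, hz, rfl⟩, hzA⟩
  refine ⟨hzA, fun a ha => ?_, fun y => ⟨⟨p (st.good y), hp _ ⟨y, rfl⟩, ?_⟩, ?_⟩⟩
  · rw [hg]
    constructor
    · rintro (rfl | h | h)
      · exact absurd ha (hnotMem _ _ hz.1)
      · exact h.2
      · exact absurd ha (hPA _ h)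
    · exact fun h => .inr (.inl ⟨ha, h⟩)
  · exact (hg _ _).2 (.inr (.inr ⟨_, ⟨y, rfl⟩, rfl⟩))
  · obtain ⟨x, hx, hxF⟩ := ((st.infinite_good hA y).sdiff (hF.insert z)).nonempty
    exact ⟨x, hx, fun h => hxF ((hg _ _).1 h)⟩

theorem nextCand_congr (st : Stage M N A n) {t u : Set (M.Obj n)}
    (h : ∀ a ∈ A n, a ∈ t ↔ a ∈ u) : st.nextCand t = st.nextCand u := by
  ext x
  refine and_congr_right fun _ => and_congr_left fun _ => forall₂_congr fun a ha => ?_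
  rw [h a ha]

theorem nextMem_map (st : Stage M N A n) {a : M.Obj (n + 1)} {z : M.Obj n} (hz : z ∈ A n) :
    st.NextMem a (st.map z) ↔ M.Mem z a := by
  constructor
  · rintro (⟨z', hz', h, e⟩ | ⟨h, -⟩)
    · rwa [st.injOn hz hz' e]
    · exact absurd rfl (h z hz)
  · exact fun h => .inl ⟨z, hz, h, rfl⟩

/-- The elements of `A n` whose images belong to `y`. -/
def trace (st : Stage M N A n) (y : N.Obj (n + 1)) : Set (M.Obj n) :=
  {a ∈ A n | N.Mem (st.map a) y}

theorem exists_succ (hM : M.IsTypeTheory) (hN : N.IsTypeTheory) (hA : ∀ n, (A n).Finite)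
    (hext : IsExtensional A) (st : Stage M N A n) :
    ∃ st' : Stage M N A (n + 1),
      (∀ a y, N.Mem y (st'.map a) ↔ st.NextMem a y) ∧
        ∀ y, st'.cand y = st.nextCand (st.trace y) := by
  choose f hf using st.isSet_nextMem hN hA
  -- The candidates for `y` depend only on the trace of `y` on `A n`, for which there are finitely
  -- many possibilities, each of them definable in `N`.
  refine ⟨⟨f, fun y => st.nextCand (st.trace y), ?_,
    fun y => st.infinite_nextCand hM hN hA _, fun y x hx => hx.1, ?_, fun C => ?_⟩,
    hf, fun _ => rfl⟩
  · intro a ha b hb hab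
    refine hext n a ha b hb fun z hz => ?_
    rw [← st.nextMem_map hz, ← st.nextMem_map hz, ← hf, ← hf, hab]
  · refine ((hA n).finite_subsets.image st.nextCand).subset ?_
    rintro _ ⟨y, rfl⟩
    exact ⟨st.trace y, fun a ha => ha.1, rfl⟩
  · have hfin : {t | t ⊆ A n ∧ st.nextCand t = C}.Finite :=
      (hA n).finite_subsets.subset fun t ht => ht.1
    have := hN.isSet_exists_mem hfin fun t _ => hN.isSet_forall_mem (hA n) fun a _ =>
      hN.isSet_iff (hN.isSet_mem (st.map a)) (a ∈ t)
    convert this using 2 with y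
    refine ⟨fun h => ⟨st.trace y, ⟨fun a ha => ha.1, h⟩, fun a ha => ?_⟩, ?_⟩
    · simp [trace, ha]
    · rintro ⟨t, ⟨-, rfl⟩, h⟩
      exact st.nextCand_congr fun a ha => by simp [trace, ha, h a ha]

/-- `x` may stand for `y`: either `y` is the image of the element `x` of `A n`, or `y` is not in the
image of `A n` and `x` is in `st.good y`. -/
def Partner (st : Stage M N A n) (y : N.Obj n) (x : M.Obj n) : Prop :=
  (x ∈ A n ∧ y = st.map x) ∨ ((∀ a ∈ A n, y ≠ st.map a) ∧ x ∈ st.good y)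

theorem exists_partner (st : Stage M N A n) (hA : ∀ n, (A n).Finite) (y : N.Obj n) :
    ∃ x, st.Partner y x := by
  by_cases h : ∃ a ∈ A n, y = st.map a
  · obtain ⟨a, ha, hy⟩ := h
    exact ⟨a, .inl ⟨ha, hy⟩⟩
  · push Not at h
    exact (st.infinite_good hA y).nonempty.imp fun x hx => .inr ⟨h, hx⟩

theorem Partner.eq_iff {st : Stage M N A n} {y : N.Obj n} {x a : M.Obj n} (h : st.Partner y x)
    (ha : a ∈ A n) : x = a ↔ y = st.map a := by
  rcases h with ⟨hx, rfl⟩ | ⟨hy, hx⟩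
  · exact (st.injOn.eq_iff hx ha).symm
  · refine iff_of_false ?_ (hy a ha)
    rintro rfl
    exact st.notMem _ _ hx.1 ha

variable {st : Stage M N A n} {st' : Stage M N A (n + 1)}

theorem Partner.mem_iff (h₁ : ∀ a y, N.Mem y (st'.map a) ↔ st.NextMem a y)
    {y : N.Obj n} {x : M.Obj n} (h : st.Partner y x) {a : M.Obj (n + 1)} (ha : a ∈ A (n + 1)) :
    M.Mem x a ↔ N.Mem y (st'.map a) := by
  rw [h₁]
  rcases h with ⟨hx, rfl⟩ | ⟨hy, hx⟩
  · rw [st.nextMem_map hx]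
  · rw [hx.2 a ha]
    refine ⟨fun h => .inr ⟨hy, h⟩, ?_⟩
    rintro (⟨z, hz, -, e⟩ | ⟨-, h⟩)
    exacts [absurd e (hy z hz), h]

theorem Partner.mem_iff_of_mem (h₁ : ∀ a y, N.Mem y (st'.map a) ↔ st.NextMem a y)
    (h₂ : ∀ y, st'.cand y = st.nextCand (st.trace y))
    {y : N.Obj (n + 1)} {x : M.Obj (n + 1)} (h : st'.Partner y x) {a : M.Obj n} (ha : a ∈ A n) :
    M.Mem a x ↔ N.Mem (st.map a) y := by
  rcases h with ⟨hx, rfl⟩ | ⟨hy, hx⟩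
  · rw [h₁, st.nextMem_map ha]
  · have hx' := hx.1
    rw [h₂] at hx'
    rw [hx'.2.1 a ha]
    simp [trace, ha]

/-- A partner can be found inside or outside of a given partner at the next type, as required,
because that partner splits all sets of candidates. -/
theorem Partner.exists_partner (hA : ∀ n, (A n).Finite)
    (h₁ : ∀ a y, N.Mem y (st'.map a) ↔ st.NextMem a y)
    (h₂ : ∀ y, st'.cand y = st.nextCand (st.trace y))
    {y' : N.Obj (n + 1)} {x' : M.Obj (n + 1)} (h : st'.Partner y' x') (y : N.Obj n) :
    ∃ x, st.Partner y x ∧ (M.Mem x x' ↔ N.Mem y y') := by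
  by_cases hy : ∃ a ∈ A n, y = st.map a
  · obtain ⟨a, ha, rfl⟩ := hy
    exact ⟨a, .inl ⟨ha, rfl⟩, h.mem_iff_of_mem h₁ h₂ ha⟩
  · push Not at hy
    rcases h with ⟨hx', rfl⟩ | ⟨-, hx'⟩
    · obtain ⟨x, hx⟩ := st.exists_partner hA y
      exact ⟨x, hx, hx.mem_iff h₁ hx'⟩
    · have hc := hx'.1
      rw [h₂] at hc
      obtain ⟨⟨z, hz, hzx⟩, z', hz', hzx'⟩ := hc.2.2 y
      by_cases hm : N.Mem y y'
      · exact ⟨z, .inr ⟨hy, hz⟩, iff_of_true hzx hm⟩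
      · exact ⟨z', .inr ⟨hy, hz'⟩, iff_of_false hzx' hm⟩

end Stage

/-- The finite sets `A n` can be mapped to `N` such that for every choice of one object of `N` of
each type below `B`, there are objects of `M` with the same atomic relations to each other and to
the elements of the sets `A n`.  They are found from the highest type downwards. -/
theorem IsTypeTheory.exists_matching (hM : M.IsTypeTheory) (hN : N.IsTypeTheory)
    {A : ∀ n, Set (M.Obj n)} (hA : ∀ n, (A n).Finite) (hext : IsExtensional A) :
    ∃ f : ∀ n, M.Obj n → N.Obj n,
      (∀ n, Set.InjOn (f n) (A n)) ∧
      (∀ n, ∀ a ∈ A n, ∀ b ∈ A (n + 1), M.Mem a b ↔ N.Mem (f n a) (f (n + 1) b)) ∧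
      ∀ (B : ℕ) (y : ∀ n, N.Obj n), ∃ x : ∀ n, M.Obj n, ∀ n < B,
        (∀ a ∈ A n, x n = a ↔ y n = f n a) ∧
        (∀ a ∈ A (n + 1), M.Mem (x n) a ↔ N.Mem (y n) (f (n + 1) a)) ∧
        (n + 1 < B → (∀ a ∈ A n, M.Mem a (x (n + 1)) ↔ N.Mem (f n a) (y (n + 1))) ∧
          (M.Mem (x n) (x (n + 1)) ↔ N.Mem (y n) (y (n + 1)))) := by
  choose next h₁ h₂ using fun n => Stage.exists_succ (n := n) hM hN hA hext
  let st : ∀ n, Stage M N A n := fun n => Nat.rec (Stage.exists_zero hM hN hA).some next n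
  have h₁ : ∀ n a y, N.Mem y ((st (n + 1)).map a) ↔ (st n).NextMem a y := fun n => h₁ n (st n)
  have h₂ : ∀ n y, (st (n + 1)).cand y = (st n).nextCand ((st n).trace y) :=
    fun n => h₂ n (st n)
  have key : ∀ (y : ∀ n, N.Obj n) (B : ℕ) (x₀ : M.Obj B), (st B).Partner (y B) x₀ →
      ∃ x : ∀ n, M.Obj n, x B = x₀ ∧ (∀ n ≤ B, (st n).Partner (y n) (x n)) ∧
        ∀ n < B, M.Mem (x n) (x (n + 1)) ↔ N.Mem (y n) (y (n + 1)) := by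
    intro y B
    induction B with
    | zero =>
      intro x₀ hx₀
      choose x hx using fun n => (st n).exists_partner hA (y n)
      refine ⟨Function.update x 0 x₀, by simp, fun n hn => ?_, fun n hn => absurd hn n.not_lt_zero⟩
      obtain rfl := Nat.le_zero.1 hn
      simpa using hx₀
    | succ B ih =>
      intro x₀ hx₀
      obtain ⟨x₁, hx₁, hmem⟩ := hx₀.exists_partner hA (h₁ B) (h₂ B) (y B)
      obtain ⟨x, hxB, hx, hxmem⟩ := ih x₁ hx₁
      refine ⟨Function.update x (B + 1) x₀, by simp, fun n hn => ?_, fun n hn => ?_⟩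
      · rcases Nat.le_succ_iff.1 hn with hn | rfl
        · rw [Function.update_of_ne (by omega)]
          exact hx n hn
        · simpa using hx₀
      · rw [Function.update_of_ne (by omega)]
        rcases Nat.lt_succ_iff_lt_or_eq.1 hn with hn | rfl
        · rw [Function.update_of_ne (by omega)]
          exact hxmem n hn
        · simpa [hxB] using hmem
  refine ⟨fun n => (st n).map, fun n => (st n).injOn, fun n a ha b hb => ?_, fun B y => ?_⟩
  · rw [h₁, (st n).nextMem_map ha]
  · obtain ⟨x₀, hx₀⟩ := (st B).exists_partner hA (y B)
    obtain ⟨x, -, hx, hmem⟩ := key y B x₀ hx₀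
    exact ⟨x, fun n hn => ⟨fun a ha => (hx n hn.le).eq_iff ha,
      fun a ha => (hx n hn.le).mem_iff (h₁ n) ha,
      fun hn' => ⟨fun a ha => (hx (n + 1) hn'.le).mem_iff_of_mem (h₁ n) (h₂ n) ha,
        hmem n hn⟩⟩⟩

end Matching

/-! ### Transfer of sentences with descending existential types -/

variable {M N : Model}

/-- The valuation below a block of quantifiers of distinct types `s`, whose variable of type `n`
denotes `y n`. -/
def pushAll (s : List ℕ) (y : ∀ n, M.Obj n) (v : M.Valuation) : M.Valuation :=
  fun n => if n ∈ s then fun i => Nat.casesOn i (y n) (v n) else v n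

theorem sat_exBlock {s : List ℕ} (hs : s.Nodup) (hM : ∀ n, Nonempty (M.Obj n)) (θ : Formula)
    (v : M.Valuation) : M.Sat (exBlock s θ) v ↔ ∃ y, M.Sat θ (pushAll s y v) := by
  induction s generalizing v with
  | nil =>
    have := hM
    have e : ∀ y, pushAll [] y v = v := fun y => by funext n; simp [pushAll]
    simp [exBlock, e]
  | cons n s ih =>
    obtain ⟨hn, hs⟩ := List.nodup_cons.1 hs
    change M.Sat (ex n (exBlock s θ)) v ↔ _
    simp only [sat_ex, ih hs]
    have e : ∀ (y : ∀ n, M.Obj n),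
        pushAll s y (push n (y n) v) = pushAll (n :: s) y v := by
      intro y
      funext m
      by_cases h : m = n
      · subst h; simp [pushAll, push, hn]
      · simp [pushAll, push, h]
    have e' : ∀ (a : M.Obj n) (y : ∀ n, M.Obj n) (v : M.Valuation),
        pushAll s (Function.update y n a) v = pushAll s y v := by
      intro a y v
      funext m
      by_cases h : m = n
      · subst h; simp [pushAll, hn]
      · simp [pushAll, h]
    constructor
    · rintro ⟨a, y, h⟩
      refine ⟨Function.update y n a, ?_⟩
      rwa [← e, e', Function.update_self]
    · rintro ⟨y, h⟩
      exact ⟨y n, y, by rwa [e]⟩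

theorem sat_iff_of_isQuantifierFree {θ : Formula} (hθ : θ.IsQuantifierFree) {v : M.Valuation}
    {w : N.Valuation} {B : ℕ} (hB : ∀ n i, θ.IsFree n i → n < B ∧ i < B)
    (heq : ∀ n i j, n < B → i < B → j < B → (v n i = v n j ↔ w n i = w n j))
    (hmem : ∀ n i j, n + 1 < B → i < B → j < B →
      (M.Mem (v n i) (v (n + 1) j) ↔ N.Mem (w n i) (w (n + 1) j))) :
    M.Sat θ v ↔ N.Sat θ w := by
  induction θ with
  | eq n i j =>
    have hi := hB n i (by simp [IsFree])
    have hj := hB n j (by simp [IsFree])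
    exact heq n i j hi.1 hi.2 hj.2
  | mem n i j =>
    have hi := hB n i (by simp [IsFree])
    have hj := hB (n + 1) j (by simp [IsFree])
    exact hmem n i j hj.1 hi.2 hj.2
  | bot => rfl
  | imp φ ψ ihφ ihψ =>
    exact imp_congr (ihφ hθ.1 fun n i h => hB n i (.inl h)) (ihψ hθ.2 fun n i h => hB n i (.inr h))
  | all => exact hθ.elim

/-- If `∃ y₁ ⋯ ∃ yₗ θ`, with one variable of each type, holds in `N` under all valuations, then also
in `M`: the values of the parameters in `M` are matched by objects of `N`, and the objects of `N`
found for these by objects of `M`. -/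
theorem IsTypeTheory.sat_exBlock_of_forall_sat (hM : M.IsTypeTheory) (hN : N.IsTypeTheory)
    {s : List ℕ} (hs : s.Nodup) {θ : Formula} (hθ : θ.IsQuantifierFree)
    (h : ∀ w, N.Sat (exBlock s θ) w) (v : M.Valuation) : M.Sat (exBlock s θ) v := by
  obtain ⟨B, hB⟩ := exists_bound θ
  obtain ⟨A, hvA, hA, hext⟩ := hM.exists_isExtensional (B := B)
    (A := fun n => {a | n < B ∧ ∃ i < B, v n i = a})
    (fun n => ((Set.finite_lt_nat B).image (v n)).subset fun a ha => ha.2)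
    (fun n hn => by ext a; simp [hn])
  obtain ⟨f, hinj, hf, hmatch⟩ := hM.exists_matching hN hA hext
  obtain ⟨y, hy⟩ := (sat_exBlock hs hN.nonempty θ _).1 (h fun n i => f n (v n i))
  obtain ⟨x, hx⟩ := hmatch B y
  refine (sat_exBlock hs hM.nonempty θ v).2 ⟨x, ?_⟩
  set V := pushAll s x v with hV
  set W := pushAll s y fun n i => f n (v n i) with hW
  -- Every relevant variable denotes a parameter and its image, or one of the chosen objects and its
  -- substitute.
  have hVW : ∀ n i, n < B → i < B →
      (V n i ∈ A n ∧ W n i = f n (V n i)) ∨ (V n i = x n ∧ W n i = y n) := by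
    intro n i hn hi
    have hmem : ∀ j < B, v n j ∈ A n := fun j hj => hvA n ⟨hn, j, hj, rfl⟩
    by_cases hns : n ∈ s
    · cases i with
      | zero => simp [hV, hW, pushAll, hns]
      | succ j => simp [hV, hW, pushAll, hns, hmem j (by omega)]
    · simp [hV, hW, pushAll, hns, hmem i hi]
  refine (sat_iff_of_isQuantifierFree hθ hB (fun n i j hn hi hj => ?_)
    fun n i j hn hi hj => ?_).2 hy
  · have hxn := (hx n hn).1
    rcases hVW n i hn hi with ⟨hi, hi'⟩ | ⟨hi, hi'⟩ <;>
      rcases hVW n j hn hj with ⟨hj, hj'⟩ | ⟨hj, hj'⟩ <;> rw [hi', hj']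
    · exact ((hinj n).eq_iff hi hj).symm
    · rw [hj, eq_comm, hxn _ hi, eq_comm]
    · rw [hi, hxn _ hj]
    · simp [hi, hj]
  · obtain ⟨-, hx₁, hx₂⟩ := hx n (by omega)
    obtain ⟨hx₂, hx₃⟩ := hx₂ hn
    rcases hVW n i (by omega) hi with ⟨hi, hi'⟩ | ⟨hi, hi'⟩ <;>
      rcases hVW (n + 1) j hn hj with ⟨hj, hj'⟩ | ⟨hj, hj'⟩ <;> rw [hi', hj']
    · exact hf n _ hi _ hj
    · rw [hj, hx₂ _ hi]
    · rw [hi, hx₁ _ hj]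
    · rw [hi, hj, hx₃]

end Model

/-- A theory whose models agree on a sentence decides it. -/
theorem decides_of_forall_model {T : Set Formula} (hT : ∀ ψ ∈ T, ψ.IsSentence) {φ : Formula}
    (hφ : φ.IsSentence)
    (h : ∀ (M N : Model) (v : M.Valuation) (_ : N.Valuation), (∀ ψ ∈ T, ∀ v, M.Sat ψ v) →
      (∀ ψ ∈ T, ∀ w, N.Sat ψ w) → (∀ w, N.Sat φ w) → M.Sat φ v) : Decides T φ := by
  by_contra hc
  rw [Decides, not_or] at hc
  have hneg : (neg φ).IsSentence := fun n i hi => hi.elim (hφ n i) id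
  obtain ⟨M, ⟨v⟩, hM⟩ := Consistent.exists_model (T := insert (neg φ) T)
    (fun hbot => hc.1 (Proves.byContradiction hbot))
    (by rintro ψ (rfl | hψ); exacts [hneg, hT ψ hψ])
  obtain ⟨N, ⟨w⟩, hN⟩ := Consistent.exists_model (T := insert φ T)
    (fun hbot => hc.2 (Proves.impIntro hbot))
    (by rintro ψ (rfl | hψ); exacts [hφ, hT ψ hψ])
  exact hM (neg φ) (.inl rfl) v (h M N v w (fun ψ hψ => hM ψ (.inr hψ))
    (fun ψ hψ => hN ψ (.inr hψ)) (hN φ (.inl rfl)))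

end TST

theorem mainTheorem1 (r s : List ℕ) (hs : s.Pairwise (fun a b => a > b))
    (θ : TST.Formula) (hθ : θ.IsQuantifierFree)
    (hφ : (TST.Formula.allBlock r (TST.Formula.exBlock s θ)).IsSentence) :
    TST.Decides TST.theoryTSTI (TST.Formula.allBlock r (TST.Formula.exBlock s θ)) := by
  refine TST.decides_of_forall_model (fun _ => TST.isSentence_of_mem_theoryTSTI) hφ
    fun M N v w hM hN hNφ => ?_
  have hM' := TST.Model.isTypeTheory_of_sat hM v
  have hN' := TST.Model.isTypeTheory_of_sat hN w
  exact TST.Model.sat_allBlock (hM'.sat_exBlock_of_forall_sat hN' (hs.imp fun h => ne_of_gt h) hθ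
    (TST.Model.sat_of_sat_allBlock hNφ)) v
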